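/- Let $(G,+,\le)$ be a partially ordered abelian group (that is, an abelian group with a translation-invariant partial order), with positive cone $G^+=\{a\in G : 0\le a\}$, and write $\mathbb N=\{1,2,3,\dots\}$. Assume that - $G$ is archimedean: whenever $a,b\in G$ satisfy $0\le \ell a+b$ for all $\ell\in\mathbb N$, then $0\le a$; - $G$ is directed: for every $a\in G$ there are $b,c\in G^+$ with $a=b-c$. Let $\mu\colon G\times G\to G$ be a biadditive binary operation (i.e. additive in each argument) such that $\mu(a,b)\in G^+$ for all $a,b\in G^+$, and let $\mu^+\colon G^+\times G^+\to G^+$ be its restriction to the commutative monoid $G^+$. If $G^+$ is weakly $\mu^+$-localizable, then $G^+$ is strongly $\mu^+$-localizable. Here the following terminology is used for a commutative monoid $M$ and a biadditive binary operation $\nu$ on $M$. The canonical quasi-order on $M$ is defined by $a\lesssim b$ if and only if there are $c,t\in M$ and $k\in\mathbb N$ such that $ka+c+t=kb+t$. An element $s\in M$ is left $\nu$-localizable if, whenever $a,b\in M$ satisfy $\nu(s,a)+a\lesssim\nu(s,b)+b$, then $a\lesssim b$; it is $\nu$-localizable if it is both left $\nu$-localizable and left $\nu^{\mathrm{op}}$-localizable,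 where $\nu^{\mathrm{op}}(a,b)=\nu(b,a)$. The monoid $M$ is weakly $\nu$-localizable if for every $a\in M$ there is a $\nu$-localizable $s\in M$ with $a\lesssim s$, and strongly $\nu$-localizable if every $s\in M$ is $\nu$-localizable. -/

import Mathlib

namespace Localizability

section Monoid

variable {M : Type*} [AddCommMonoid M]

/-- The canonical quasi-order `a ≲ b` on a commutative monoid. -/
def CanLE (a b : M) : Prop :=
  ∃ (c t : M) (k : ℕ), 0 < k ∧ k • a + c + t = k • b + t

/-- A binary operation that is additive in each argument. -/
structure IsBiadditive (μ : M → M → M) : Prop where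
  add_left : ∀ a a' b : M, μ (a + a') b = μ a b + μ a' b
  add_right : ∀ b a a' : M, μ b (a + a') = μ b a + μ b a'

/-- The opposite operation. -/
def opposite (μ : M → M → M) : M → M → M := fun a b => μ b a

/-- Left `μ`-localizable elements. -/
def IsLeftLocalizable (μ : M → M → M) (s : M) : Prop :=
  ∀ a b : M, CanLE (μ s a + a) (μ s b + b) → CanLE a b

/-- `μ`-localizable elements. -/
def IsLocalizable (μ : M → M → M) (s : M) : Prop :=
  IsLeftLocalizable μ s ∧ IsLeftLocalizable (opposite μ) s

/-- The commutative monoid `M` is weakly `μ`-localizable. -/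
def WeaklyLocalizable (μ : M → M → M) : Prop :=
  ∀ a : M, ∃ s : M, IsLocalizable μ s ∧ CanLE a s

/-- The commutative monoid `M` is strongly `μ`-localizable. -/
def StronglyLocalizable (μ : M → M → M) : Prop :=
  ∀ s : M, IsLocalizable μ s

end Monoid

section Group

variable (G : Type*) [AddCommGroup G] [PartialOrder G] [IsOrderedAddMonoid G]

/-- The archimedean property of a partially ordered abelian group. This is not the Mathlib class
`Archimedean`, which is a different condition when the order is not total. -/
def IsArchimedeanGroup : Prop :=
  ∀ a b : G, (∀ l : ℕ, 0 < l → 0 ≤ l • a + b) → 0 ≤ a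

/-- A partially ordered abelian group is directed if every element is a difference of two
elements of the positive cone. -/
def IsDirectedGroup : Prop :=
  ∀ a : G, ∃ b c : G, 0 ≤ b ∧ 0 ≤ c ∧ a = b - c

variable {G}

/-- The restriction `μ⁺` of a positivity-preserving binary operation to the positive cone `G⁺`. -/
def restrictNonneg (μ : G → G → G) (hμ : ∀ a b : G, 0 ≤ a → 0 ≤ b → 0 ≤ μ a b) :
    AddSubmonoid.nonneg G → AddSubmonoid.nonneg G → AddSubmonoid.nonneg G :=
  fun a b => ⟨μ a b, hμ a b a.2 b.2⟩

/-- The restriction of a biadditive operation is a biadditive operation on the monoid `G⁺`. -/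
theorem IsBiadditive.restrictNonneg {μ : G → G → G} (h : IsBiadditive μ)
    (hμ : ∀ a b : G, 0 ≤ a → 0 ≤ b → 0 ≤ μ a b) :
    IsBiadditive (restrictNonneg μ hμ) where
  add_left a a' b := Subtype.ext (h.add_left a a' b)
  add_right b a a' := Subtype.ext (h.add_right b a a')

end Group

end Localizability

namespace Localizability

/-! On `G⁺` the quasi-order `≲` is the order of `G`, so localizability of `s` says that `1 + A` is
inverse-positive, where `A = μ s`. Take a localizable `s' ≥ s` and put `P = μ (s' - s)`, so `T = 1 +
A + P` is inverse-positive. A Neumann-type iteration carries this to `T + m(T - P) = (m + 1)(1 + A)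
+ P` for every `m`, and the archimedean property removes the relatively small `P` as `m` grows. -/

theorem exists_mul_pow_le_succ_pow (m l : ℕ) : ∃ j : ℕ, l * m ^ j ≤ (m + 1) ^ j := by
  rcases Nat.eq_zero_or_pos m with rfl | hm
  · exact ⟨1, by simp⟩
  -- Bernoulli's inequality `1 + j/m ≤ (1 + 1/m)^j`, cleared of denominators.
  · have key : ∀ j : ℕ, (m + j) * m ^ j ≤ (m + 1) ^ j * m := by
      intro j
      induction j with
      | zero => simp
      | succ j ih =>
        calc (m + (j + 1)) * m ^ (j + 1) = (m * (m + (j + 1))) * m ^ j := by ring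
          _ ≤ ((m + 1) * (m + j)) * m ^ j := Nat.mul_le_mul_right _ (by nlinarith)
          _ = (m + 1) * ((m + j) * m ^ j) := by ring
          _ ≤ (m + 1) * ((m + 1) ^ j * m) := by gcongr
          _ = (m + 1) ^ (j + 1) * m := by ring
    refine ⟨l * m, Nat.le_of_mul_le_mul_right ?_ hm⟩
    calc l * m ^ (l * m) * m = (l * m) * m ^ (l * m) := by ring
      _ ≤ (m + l * m) * m ^ (l * m) := by gcongr; omega
      _ ≤ _ := key _

section Group

variable {G : Type*} [AddCommGroup G] [PartialOrder G] [IsOrderedAddMonoid G]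

/-- Archimedean directed partially ordered abelian groups are unperforated. -/
theorem nonneg_of_nsmul_nonneg (hArch : IsArchimedeanGroup G) (hDir : IsDirectedGroup G)
    {k : ℕ} (hk : 0 < k) {a : G} (h : 0 ≤ k • a) : 0 ≤ a := by
  obtain ⟨b, c, hb, hc, rfl⟩ := hDir a
  -- With `l = qk + r`, the remainder `r • (b - c)` is bounded below by `-k • c`, uniformly in `l`.
  refine hArch _ (k • c) fun l _ => ?_
  have hr : l % k ≤ k := (Nat.mod_lt l hk).le
  have e : l • (b - c) + k • c
      = (l / k) • (k • (b - c)) + ((l % k) • b + (k - l % k) • c) := by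
    conv_lhs => rw [← Nat.div_add_mod l k]
    obtain ⟨d, hd⟩ := Nat.exists_eq_add_of_le hr
    have hd' : k - l % k = d := by omega
    have hkc : k • c = (l % k) • c + d • c := by rw [← add_nsmul, ← hd]
    rw [hd', hkc, add_nsmul, mul_comm, mul_nsmul', smul_sub (l % k)]
    abel
  rw [e]
  exact add_nonneg (nsmul_nonneg h _) (add_nonneg (nsmul_nonneg hb _) (nsmul_nonneg hc _))

/-- If `T` is inverse-positive and dominates `P` on the positive cone, then `T + m • (T - P)` is
inverse-positive. -/
theorem nonneg_of_add_nsmul_sub_nonneg (hArch : IsArchimedeanGroup G) (hDir : IsDirectedGroup G)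
    (T P : G →+ G) (hP : ∀ a, 0 ≤ a → 0 ≤ P a) (hPT : ∀ a, 0 ≤ a → P a ≤ T a)
    (hT : ∀ c, 0 ≤ T c → 0 ≤ c) (m : ℕ) {c : G} (h : 0 ≤ T c + m • (T c - P c)) : 0 ≤ c := by
  obtain ⟨b, a, hb, ha, rfl⟩ := hDir c
  set c := b - a with hc
  have hca : 0 ≤ c + a := by simpa [hc] using hb
  -- Formally `c ≥ -(m/(m+1))^j a`: each application of inverse-positivity of `T` gains a factor
  -- `m/(m+1)`.
  have key : ∀ j : ℕ, 0 ≤ (m + 1) ^ j • c + m ^ j • a := by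
    intro j
    induction j with
    | zero => simpa using hca
    | succ j ih =>
      apply hT
      have h1 : 0 ≤ (m + 1) ^ j • (T c + m • (T c - P c)) := nsmul_nonneg h _
      have h2 : 0 ≤ m • P ((m + 1) ^ j • c + m ^ j • a) := nsmul_nonneg (hP _ ih) _
      have h3 : 0 ≤ m ^ (j + 1) • (T a - P a) := nsmul_nonneg (sub_nonneg.2 (hPT a ha)) _
      refine (add_nonneg (add_nonneg h1 h2) h3).trans_eq ?_
      simp only [map_add, map_nsmul]
      module
  refine hArch c a fun l _ => ?_
  obtain ⟨j, hj⟩ := exists_mul_pow_le_succ_pow m l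
  obtain ⟨d, hd⟩ := Nat.exists_eq_add_of_le hj
  refine nonneg_of_nsmul_nonneg hArch hDir (k := (m + 1) ^ j) (by positivity) ?_
  refine (add_nonneg (nsmul_nonneg (key j) l) (nsmul_nonneg ha d)).trans_eq ?_
  rw [smul_add ((m + 1) ^ j), smul_add l, smul_smul, smul_smul, smul_smul, mul_comm l ((m + 1) ^ j),
    add_assoc, ← add_nsmul, ← hd]

/-- Inverse-positivity of `1 + A + P` passes to `1 + A`, for positive additive maps `A`, `P`. -/
theorem nonneg_of_add_nonneg (hArch : IsArchimedeanGroup G) (hDir : IsDirectedGroup G)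
    (A P : G →+ G) (hA : ∀ a, 0 ≤ a → 0 ≤ A a) (hP : ∀ a, 0 ≤ a → 0 ≤ P a)
    (hAP : ∀ c, 0 ≤ c + A c + P c → 0 ≤ c) {c : G} (h : 0 ≤ c + A c) : 0 ≤ c := by
  obtain ⟨b, a, hb, ha, rfl⟩ := hDir c
  set c := b - a with hc
  have hca : 0 ≤ c + a := by simpa [hc] using hb
  -- The shift `P a` works because `(m + 1)(1 + A) + P` sends `(m + 1)c + P a` to a sum in which `P
  -- c` and `P a` combine into `(m + 1)P(c + a) ≥ 0`.
  refine hArch c (P a) fun l hl => ?_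
  obtain ⟨m, rfl⟩ : ∃ m, l = m + 1 := ⟨l - 1, by omega⟩
  refine nonneg_of_add_nsmul_sub_nonneg hArch hDir (AddMonoidHom.id G + A + P) P hP
    (fun x hx => ?_) hAP m ?_
  · simpa using add_nonneg hx (hA x hx)
  · have h1 : 0 ≤ (m + 1) ^ 2 • (c + A c) := nsmul_nonneg h _
    have h2 : 0 ≤ (m + 1) • P (c + a) := nsmul_nonneg (hP _ hca) _
    have h3 : 0 ≤ (m + 1) • A (P a) := nsmul_nonneg (hA _ (hP a ha)) _
    have h4 : 0 ≤ P (P a) := hP _ (hP a ha)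
    refine (add_nonneg (add_nonneg (add_nonneg h1 h2) h3) h4).trans_eq ?_
    simp only [AddMonoidHom.add_apply, AddMonoidHom.id_apply, map_add, map_nsmul]
    module

theorem canLE_nonneg_iff (hArch : IsArchimedeanGroup G) (hDir : IsDirectedGroup G)
    (a b : AddSubmonoid.nonneg G) : CanLE a b ↔ (a : G) ≤ b := by
  constructor
  · rintro ⟨c, t, k, hk, h⟩
    have h' : k • (a : G) + c + t = k • (b : G) + t := by
      simpa using congrArg (Subtype.val) h
    have h'' : k • ((b : G) - a) = c := by
      rw [smul_sub, ← add_right_cancel h']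
      abel
    exact sub_nonneg.1 (nonneg_of_nsmul_nonneg hArch hDir hk (h'' ▸ c.2))
  · intro h
    exact ⟨⟨b - a, sub_nonneg.2 h⟩, 0, 1, one_pos, Subtype.ext (by simp)⟩

/-- Left localizability in the positive cone is inverse-positivity of `c ↦ μ s c + c`. -/
theorem isLeftLocalizable_restrictNonneg_iff (hArch : IsArchimedeanGroup G)
    (hDir : IsDirectedGroup G) {μ : G → G → G} (hbi : IsBiadditive μ)
    (hμ : ∀ a b : G, 0 ≤ a → 0 ≤ b → 0 ≤ μ a b) (s : AddSubmonoid.nonneg G) :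
    IsLeftLocalizable (restrictNonneg μ hμ) s ↔ ∀ c : G, 0 ≤ c + μ s c → 0 ≤ c := by
  have e : ∀ a b : G, b - a + μ s (b - a) = μ s b + b - (μ s a + a) := fun a b => by
    have := hbi.add_right s (b - a) a
    rw [sub_add_cancel] at this
    rw [this]
    abel
  simp only [IsLeftLocalizable, canLE_nonneg_iff hArch hDir]
  constructor
  · intro h c hc
    obtain ⟨b, a, hb, ha, rfl⟩ := hDir c
    rw [e] at hc
    exact sub_nonneg.2 (h ⟨a, ha⟩ ⟨b, hb⟩ (sub_nonneg.1 hc))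
  · intro h a b hab
    refine sub_nonneg.1 (h _ ?_)
    rw [e]
    exact sub_nonneg.2 hab

/-- Left localizability is inherited by smaller elements of the positive cone. -/
theorem IsLeftLocalizable.of_le (hArch : IsArchimedeanGroup G)
    (hDir : IsDirectedGroup G) {μ : G → G → G} (hbi : IsBiadditive μ)
    (hμ : ∀ a b : G, 0 ≤ a → 0 ≤ b → 0 ≤ μ a b) {s s' : AddSubmonoid.nonneg G}
    (hs' : IsLeftLocalizable (restrictNonneg μ hμ) s') (h : (s : G) ≤ s') :
    IsLeftLocalizable (restrictNonneg μ hμ) s := by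
  rw [isLeftLocalizable_restrictNonneg_iff hArch hDir hbi] at hs' ⊢
  intro c hc
  refine nonneg_of_add_nonneg hArch hDir (AddMonoidHom.mk' (μ s) (hbi.add_right s))
    (AddMonoidHom.mk' (μ (s' - s : G)) (hbi.add_right _)) (fun a => hμ _ _ s.2)
    (fun a => hμ _ _ (sub_nonneg.2 h)) (fun x hx => hs' x ?_) hc
  have := hbi.add_left s (s' - s) x
  rw [add_sub_cancel] at this
  rw [this, ← add_assoc]
  exact hx

end Group

end Localizability

theorem mainTheorem7 {G : Type*} [AddCommGroup G] [PartialOrder G] [IsOrderedAddMonoid G]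
    (hArch : Localizability.IsArchimedeanGroup G) (hDir : Localizability.IsDirectedGroup G)
    (μ : G → G → G) (hbi : Localizability.IsBiadditive μ)
    (hμ : ∀ a b : G, 0 ≤ a → 0 ≤ b → 0 ≤ μ a b)
    (hweak : Localizability.WeaklyLocalizable (Localizability.restrictNonneg μ hμ)) :
    Localizability.StronglyLocalizable (Localizability.restrictNonneg μ hμ) := by
  intro s
  obtain ⟨s', ⟨hl, hr⟩, hle⟩ := hweak s
  rw [Localizability.canLE_nonneg_iff hArch hDir] at hle
  exact ⟨Localizability.IsLeftLocalizable.of_le hArch hDir hbi hμ hl hle,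
    Localizability.IsLeftLocalizable.of_le hArch hDir (μ := Localizability.opposite μ)
      ⟨fun a a' b => hbi.add_right b a a', fun b a a' => hbi.add_left a a' b⟩ (fun a b ha hb => hμ b a hb ha) hr hle⟩
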